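/- Let $\lambda>0$, $T>0$, $\Omega>0$ and $\nu\ge 0$. Put $\mathcal M_\lambda(x)=x-2\lambda\lfloor (x+\lambda)/(2\lambda)\rfloor$, $f_s=1/T$, $B=\Omega/(2\pi)$ and $\mathrm{OF}=f_s/(2B)$. Let $g\in \mathrm{PW}_\Omega$, that is, $g:\mathbb R\to\mathbb R$ is a (continuous) real signal of finite energy whose Fourier transform vanishes outside $[-\Omega,\Omega]$, with $\|g\|_\infty<\infty$. Let the sampling times be $t_k=kT+\mu_k$, $k\in\mathbb Z$, with $|\mu_k|\le \nu T$ for all $k$. Let $\gamma[k]=g(t_k)$, let $\eta[k]$ be a bounded real noise sequence, and let $y_\eta[k]=\mathcal M_\lambda(\gamma[k]+\eta[k])$. Put $\rho=\|g\|_\infty/\lambda$ and $\rho_\eta=\|\eta\|_\infty/\lambda$. The second-order recovery scheme RSoD takes $y_\eta$, $\lambda$ and a bound $\beta_g\ge\|g\|_\infty$. With $(\Delta x)[k]=x[k+1]-x[k]$ and the anti-difference $(\mathrm S x)[k]=\sum_{m=1}^{k-1}x[m]$ for $k\ge 1$ (so $(\mathrm Sx)[1]=0$), continued to $k\le 0$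 by $(\mathrm S x)[k]=-\sum_{m=k}^{0}x[m]$, and with $\lfloor\cdot\rceil$ denoting rounding to the nearest integer, it computes $$r=\mathcal M_\lambda(\Delta^2y_\eta)-\Delta^2y_\eta,\qquad J=\Bigl\lceil 4\Bigl(\frac{\beta_g}{\lambda}+1\Bigr)\Bigr\rceil,\qquad \kappa=\Bigl\lfloor \frac{(\mathrm S^2r)[1]-(\mathrm S^2r)[J+1]}{2J\lambda}+\frac12\Bigr\rfloor,$$ $$s[k]=2\lambda\Bigl\lfloor\frac{(\mathrm S r)[k]}{2\lambda}\Bigr\rceil+2\lambda\kappa,\qquad \tilde\gamma[k]=(\mathrm S s)[k]+y_\eta[k]+2m_0\lambda,$$ where $m_0\in\mathbb Z$ is arbitrary. (i) If $$\rho\bigl((T\Omega)^2+4\nu T\Omega\bigr)+4\rho_\eta<1,\qquad(\ast)$$ then for every $\beta_g\ge\|g\|_\infty$ there is an integer $c$ such that, for every choice of $m_0$, the output is $\tilde\gamma[k]=\gamma[k]+\eta[k]+2m\lambda$ for all $k\in\mathbb Z$, with $m=m_0+c$ independent of $k$. That is, $\gamma+\eta$ is recovered exactly up to a global multiple of $2\lambda$.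 (ii) If $\rho>0$ and $\rho_\eta<\frac14$, then $(\ast)$ is equivalent to $$T\Omega<-2\nu+\sqrt{4\nu^2+\frac{1-4\rho_\eta}{\rho}},$$ and also to $$\mathrm{OF}>\frac{\pi}{-2\nu+\sqrt{4\nu^2+\frac{1-4\rho_\eta}{\rho}}}.$$ -/

import Mathlib

open MeasureTheory
open scoped FourierTransform

noncomputable section

/-- Membership in the Paley-Wiener space `PW_Ω`: `g` is (the continuous representative of) a real
signal of finite energy whose Fourier transform vanishes outside `[-Ω, Ω]`. The transform is the
one on `L²(ℝ)`; Mathlib's frequency variable `ξ` is in hertz, the angular frequency is `2 π ξ`. -/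
structure IsPaleyWiener (Ω : ℝ) (g : ℝ → ℝ) : Prop where
  continuous : Continuous g
  memLp : MemLp (fun t : ℝ => (g t : ℂ)) 2 volume
  bandlimited : ∀ᵐ ξ : ℝ, Ω < |2 * Real.pi * ξ| →
    (𝓕 (memLp.toLp (fun t : ℝ => (g t : ℂ))) : Lp ℂ 2 (volume : Measure ℝ)) ξ = 0

/-- The sup norm of a function or sequence (used for bounded ones only). -/
def supNorm {ι : Type*} (f : ι → ℝ) : ℝ := ⨆ i, |f i|

/-- The modulo operation `M_l`, folding a real number into `[-l, l)`. -/
def modFold (l x : ℝ) : ℝ := x - 2 * l * (⌊(x + l) / (2 * l)⌋ : ℝ)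

/-- The anti-difference operator: `(S x)[k] = ∑_{m=1}^{k-1} x[m]` for `k ≥ 1` (so `(S x)[1] = 0`),
continued to `k ≤ 0` by `(S x)[k] = -∑_{m=k}^{0} x[m]`. In either case one of the two sums is
empty. It is the inverse of the forward difference on the sequences that vanish at `1`. -/
def antiDiff (x : ℤ → ℝ) (k : ℤ) : ℝ := ∑ m ∈ Finset.Ico 1 k, x m - ∑ m ∈ Finset.Ico k 1, x m

/-- The oversampling factor `f_s / (2 B)`, with `f_s = 1 / T` and `B = Ω / (2 π)`. -/
def oversamplingFactor (T Ω : ℝ) : ℝ := (1 / T) / (2 * (Ω / (2 * Real.pi)))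

namespace RSoD

/-- The candidate second difference of the residue: `M_l(Δ² y) - Δ² y`. -/
def resDiff (l : ℝ) (y : ℤ → ℝ) (k : ℤ) : ℝ :=
  modFold l ((fwdDiff (1 : ℤ))^[2] y k) - (fwdDiff (1 : ℤ))^[2] y k

/-- The block length `J = ⌈4 (β / l + 2 ^ (N - 2))⌉` for `N = 2`. -/
def blockLength (l β : ℝ) : ℤ := ⌈4 * (β / l + 1)⌉

/-- The integer `κ` that fixes the constant lost in the first anti-difference. -/
def kappa (l β : ℝ) (y : ℤ → ℝ) : ℤ :=
  ⌊(antiDiff (antiDiff (resDiff l y)) 1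
      - antiDiff (antiDiff (resDiff l y)) (blockLength l β + 1))
    / (2 * (blockLength l β : ℝ) * l) + 1 / 2⌋

/-- The first anti-difference, rounded to `2 l ℤ` and corrected by `2 l κ`. -/
def firstDiff (l β : ℝ) (y : ℤ → ℝ) (k : ℤ) : ℝ :=
  2 * l * (round (antiDiff (resDiff l y) k / (2 * l)) : ℝ) + 2 * l * (kappa l β y : ℝ)

/-- The output `γ̃` of the second-order difference recovery (RSoD) on noisy modulo samples `y`,
with threshold `l` and amplitude prior `β`. The free integer `m` in the last step is an
argument. -/
def recover (l β : ℝ) (y : ℤ → ℝ) (m : ℤ) (k : ℤ) : ℝ :=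
  antiDiff (firstDiff l β y) k + y k + 2 * (m : ℝ) * l

end RSoD

end

/-!
By Bernstein's inequality the second difference of the noisy samples is smaller than `l`, so that
folding `Δ² y` restores it, and `resDiff l y` is the second difference of the residue `2 l e`, with
`e` integer valued. The first anti-difference loses the constant `2 l (Δ e)[1]`, which makes the
second one drift linearly; the residue itself is bounded, so over a block of length `J` the drift
dominates and `κ` reads the constant off exactly. The constant lost by the last anti-difference is
the global multiple of `2 l`.

Bernstein's inequality comes from M. Riesz' interpolation formula: on `[-Ω, Ω]` the multiplier `w`
of the derivative agrees with a triangle wave, whose sine series turns the derivative into an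
absolutely convergent combination of symmetric differences, of total weight `Ω / 2`.
-/

section TrigSeries

open Real

theorem hasSum_cos_nat_mul_div_sq {x : ℝ} (hx : x ∈ Set.Icc 0 1) :
    HasSum (fun n : ℕ => cos (2 * π * n * x) / n ^ 2) (π ^ 2 * (x ^ 2 - x + 1 / 6)) := by
  have hB : ((Polynomial.bernoulli (2 * 1)).map (algebraMap ℚ ℝ)).eval x = x ^ 2 - x + 6⁻¹ :=
    bernoulliFun_two x
  have h := hasSum_one_div_nat_pow_mul_cos one_ne_zero hx
  rw [hB] at h
  convert! h using 1
  · simp only [mul_one, one_div_mul_eq_div]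
  · rw [mul_one, Nat.factorial_two]
    push_cast
    ring

theorem hasSum_cos_odd_mul_div_sq {x : ℝ} (hx : x ∈ Set.Icc 0 (1 / 2)) :
    HasSum (fun n : ℕ => cos (2 * π * (2 * n + 1) * x) / (2 * n + 1) ^ 2)
      (π ^ 2 * (1 / 8 - x / 2)) := by
  let f : ℕ → ℝ := fun n => cos (2 * π * n * x) / n ^ 2
  have hall : HasSum f (π ^ 2 * (x ^ 2 - x + 1 / 6)) :=
    hasSum_cos_nat_mul_div_sq ⟨hx.1, by linarith [hx.2]⟩
  have heven : HasSum (fun n => f (2 * n)) (1 / 4 * (π ^ 2 * ((2 * x) ^ 2 - 2 * x + 1 / 6))) := by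
    convert! (hasSum_cos_nat_mul_div_sq (x := 2 * x)
      ⟨by linarith [hx.1], by linarith [hx.2]⟩).mul_left (1 / 4) using 2 with n
    simp only [f, Nat.cast_mul, Nat.cast_ofNat]
    ring_nf
  have hodd : HasSum (fun n => f (2 * n + 1)) (∑' n, f (2 * n + 1)) :=
    (hall.summable.comp_injective fun a b h => by simpa using h).hasSum
  have hsum := (heven.even_add_odd hodd).unique hall
  convert! hodd using 1
  · simp only [f, Nat.cast_add, Nat.cast_mul, Nat.cast_ofNat, Nat.cast_one]
  · linarith

theorem hasSum_sin_odd_mul_div_sq {u : ℝ} (hu : |u| ≤ π / 2) :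
    HasSum (fun n : ℕ => (-1) ^ n / (2 * n + 1) ^ 2 * sin ((2 * n + 1) * u)) (π * u / 4) := by
  have hux : |u / (2 * π)| ≤ 1 / 4 := by
    rw [abs_div, abs_of_pos two_pi_pos, div_le_iff₀ two_pi_pos]
    linarith
  obtain ⟨h₁, h₂⟩ := abs_le.mp hux
  have h := hasSum_cos_odd_mul_div_sq (x := 1 / 4 - u / (2 * π)) ⟨by linarith, by linarith⟩
  convert! h using 1
  · ext n
    have hshift : 2 * π * (2 * n + 1) * (1 / 4 - u / (2 * π))
        = (π / 2 - (2 * n + 1) * u) + n * π := by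
      field_simp
      ring
    rw [hshift, cos_add_nat_mul_pi, cos_pi_div_two_sub]
    ring
  · field_simp
    ring

end TrigSeries

section RieszInterpolation

open Real

variable {Ω : ℝ}

/-- The half-period nodes `(2 n + 1) π / (2 Ω)` of M. Riesz' interpolation formula for the
derivative of a function with spectrum in `[-Ω, Ω]`. -/
noncomputable def rieszNode (Ω : ℝ) (n : ℕ) : ℝ := (2 * n + 1) * (π / (2 * Ω))

/-- The weights of M. Riesz' interpolation formula, for the one-sided sum over `n` of the symmetric
differences `f (t + rieszNode Ω n) - f (t - rieszNode Ω n)`. -/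
noncomputable def rieszWeight (Ω : ℝ) (n : ℕ) : ℝ := 4 * Ω / π ^ 2 * ((-1) ^ n / (2 * n + 1) ^ 2)

theorem hasSum_rieszWeight_mul_sin (hΩ : 0 < Ω) {w : ℝ} (hw : |w| ≤ Ω) :
    HasSum (fun n => rieszWeight Ω n * (2 * sin (rieszNode Ω n * w))) w := by
  have hu : |π / (2 * Ω) * w| ≤ π / 2 := by
    rw [abs_mul, abs_of_pos (by positivity)]
    calc π / (2 * Ω) * |w| ≤ π / (2 * Ω) * Ω := by gcongr
      _ = π / 2 := by field_simp
  convert! (hasSum_sin_odd_mul_div_sq hu).mul_left (8 * Ω / π ^ 2) using 1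
  · ext n
    rw [rieszWeight, rieszNode, mul_assoc _ (π / (2 * Ω))]
    ring
  · field_simp
    ring

theorem hasSum_abs_rieszWeight (hΩ : 0 < Ω) :
    HasSum (fun n => |rieszWeight Ω n|) (Ω / 2) := by
  have h := (hasSum_rieszWeight_mul_sin hΩ (abs_of_pos hΩ).le).div_const 2
  refine h.congr_fun fun n => ?_
  have hsin : sin (rieszNode Ω n * Ω) = (-1) ^ n := by
    have harg : rieszNode Ω n * Ω = π / 2 + n * π := by
      rw [rieszNode]
      field_simp
      ring
    rw [harg, sin_add_nat_mul_pi, sin_pi_div_two, mul_one]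
  rw [hsin, rieszWeight, abs_mul, abs_div ((-1 : ℝ) ^ n), abs_neg_one_pow,
    abs_of_pos (by positivity : 0 < 4 * Ω / π ^ 2), abs_of_pos (by positivity)]
  have hsq : (-1 : ℝ) ^ n * (-1) ^ n = 1 := by rw [← mul_pow, neg_one_mul, neg_neg, one_pow]
  linear_combination -(4 * Ω / π ^ 2 / (2 * n + 1) ^ 2) * hsq

theorem fourierChar_neg_mul_add_sub (v t a : ℝ) :
    (𝐞 (-(v * (t + a))) : ℂ) - 𝐞 (-(v * (t - a)))
      = -Complex.I * (2 * sin (a * (2 * π * v)) : ℝ) * 𝐞 (-(v * t)) := by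
  have hmul (s : ℝ) : (𝐞 (-(v * (t + s))) : ℂ)
      = 𝐞 (-(v * t)) * Complex.exp (-(s * (2 * π * v) : ℝ) * Complex.I) := by
    rw [fourierChar_apply, fourierChar_apply, ← Complex.exp_add]
    push_cast
    ring_nf
  rw [sub_eq_add_neg t, hmul, hmul, neg_mul a, Complex.ofReal_mul 2, Complex.ofReal_ofNat,
    Complex.ofReal_sin, Complex.two_sin, Complex.ofReal_neg, neg_neg]
  generalize Complex.exp (_ * Complex.I) = p
  generalize Complex.exp (_ * Complex.I) = q
  linear_combination ((p - q) * 𝐞 (-(v * t))) * Complex.I_mul_I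

theorem hasSum_rieszWeight_mul_fourierChar (hΩ : 0 < Ω) {v : ℝ} (hv : |2 * π * v| ≤ Ω) (t : ℝ) :
    HasSum (fun n => (rieszWeight Ω n : ℂ) *
        (𝐞 (-(v * (t + rieszNode Ω n))) - 𝐞 (-(v * (t - rieszNode Ω n)))))
      (-2 * π * Complex.I * v * 𝐞 (-(v * t))) := by
  convert! (Complex.hasSum_ofReal.mpr (hasSum_rieszWeight_mul_sin hΩ hv)).mul_left
    (-Complex.I * 𝐞 (-(v * t))) using 1
  · ext n
    rw [fourierChar_neg_mul_add_sub, Complex.ofReal_mul (rieszWeight Ω n)]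
    ring
  · push_cast
    ring

end RieszInterpolation

section Bernstein

open Real

variable {E : Type*} [NormedAddCommGroup E] [NormedSpace ℂ E] {Ω : ℝ} {G : ℝ → E}

/-- `G` is an integrable spectrum supported in `[-Ω, Ω]`, where `Ω` is an angular frequency and the
argument of `G` is in hertz, so that `𝓕 G` is a signal of bandwidth `Ω`. -/
structure IsBandlimitedSpectrum (Ω : ℝ) (G : ℝ → E) : Prop where
  integrable : Integrable G
  ae_eq_zero : ∀ᵐ v : ℝ, Ω < |2 * π * v| → G v = 0

namespace IsBandlimitedSpectrum

theorem integrable_smul (hG : IsBandlimitedSpectrum Ω G) : Integrable fun v : ℝ => v • G v := by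
  refine (hG.integrable.norm.const_mul (|Ω| / (2 * π))).mono'
    (continuous_id.aestronglyMeasurable.smul hG.integrable.1) ?_
  filter_upwards [hG.ae_eq_zero] with v hv
  rcases lt_or_ge Ω |2 * π * v| with h | h
  · rw [hv h]
    simp only [smul_zero, norm_zero, mul_zero, le_refl]
  · rw [abs_mul, abs_of_pos two_pi_pos] at h
    rw [norm_smul, norm_eq_abs]
    gcongr
    rw [le_div_iff₀ two_pi_pos, mul_comm]
    exact h.trans (le_abs_self Ω)

theorem derivSpectrum (hG : IsBandlimitedSpectrum Ω G) :
    IsBandlimitedSpectrum Ω fun v : ℝ => (-2 * π * Complex.I * v) • G v where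
  integrable := by
    simpa only [mul_smul, Complex.coe_smul] using!
      hG.integrable_smul.smul (-2 * π * Complex.I : ℂ)
  ae_eq_zero := by
    filter_upwards [hG.ae_eq_zero] with v hv h
    rw [hv h, smul_zero]

theorem deriv_fourier (hG : IsBandlimitedSpectrum Ω G) :
    deriv (𝓕 G) = 𝓕 fun v : ℝ => (-2 * π * Complex.I * v) • G v :=
  Real.deriv_fourier hG.integrable hG.integrable_smul

theorem differentiable_fourier (hG : IsBandlimitedSpectrum Ω G) : Differentiable ℝ (𝓕 G) :=
  fun t => (hasDerivAt_fourier hG.integrable hG.integrable_smul t).differentiableAt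

theorem contDiff_fourier (hG : IsBandlimitedSpectrum Ω G) (n : ℕ) : ContDiff ℝ n (𝓕 G) := by
  induction n generalizing G with
  | zero => exact contDiff_zero.2 hG.differentiable_fourier.continuous
  | succ n ih =>
    rw [Nat.cast_succ, contDiff_succ_iff_deriv]
    exact ⟨hG.differentiable_fourier, fun h => absurd h (by simp),
      hG.deriv_fourier ▸ ih hG.derivSpectrum⟩

theorem hasSum_rieszWeight_smul (hΩ : 0 < Ω) (hG : IsBandlimitedSpectrum Ω G) (t : ℝ) :
    HasSum (fun n => rieszWeight Ω n • (𝓕 G (t + rieszNode Ω n) - 𝓕 G (t - rieszNode Ω n)))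
      (deriv (𝓕 G) t) := by
  have hint (s : ℝ) : Integrable fun v => 𝐞 (-(v * s)) • G v := by
    simp_rw [mul_comm _ s]
    exact (fourierIntegral_convergent_iff s).2 hG.integrable
  have h := hasSum_integral_of_dominated_convergence (μ := volume)
    (F := fun n v => rieszWeight Ω n •
      (𝐞 (-(v * (t + rieszNode Ω n))) • G v - 𝐞 (-(v * (t - rieszNode Ω n))) • G v))
    (f := fun v => 𝐞 (-(v * t)) • (-2 * π * Complex.I * v) • G v)
    (fun n v => |rieszWeight Ω n| * (2 * ‖G v‖))
    (fun n => (((hint _).sub (hint _)).smul _).1) ?_ ?_ ?_ ?_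
  · simpa only [integral_smul, integral_sub (hint _) (hint _), hG.deriv_fourier,
      Real.fourier_real_eq] using h
  · intro n
    refine .of_forall fun v => ?_
    rw [norm_smul, norm_eq_abs, two_mul]
    gcongr
    simpa only [Circle.norm_smul] using
      norm_sub_le (𝐞 (-(v * (t + rieszNode Ω n))) • G v) (𝐞 (-(v * (t - rieszNode Ω n))) • G v)
  · exact .of_forall fun v => (hasSum_abs_rieszWeight hΩ).summable.mul_right _
  · simp_rw [tsum_mul_right]
    exact (hG.integrable.norm.const_mul 2).const_mul _
  · filter_upwards [hG.ae_eq_zero] with v hv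
    rcases lt_or_ge Ω |2 * π * v| with h | h
    · simp only [hv h, smul_zero, sub_zero, hasSum_zero]
    · convert! (hasSum_rieszWeight_mul_fourierChar hΩ h t).smul_const (G v) using 1
      · ext n
        rw [mul_smul, sub_smul, Complex.coe_smul, Circle.smul_def, Circle.smul_def]
      · rw [Circle.smul_def, smul_smul, mul_comm]

theorem norm_deriv_fourier_le {M : ℝ} (hΩ : 0 < Ω) (hG : IsBandlimitedSpectrum Ω G)
    (hM : ∀ t, ‖𝓕 G t‖ ≤ M) (t : ℝ) : ‖deriv (𝓕 G) t‖ ≤ Ω * M := by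
  rw [← (hG.hasSum_rieszWeight_smul hΩ t).tsum_eq]
  calc _ ≤ Ω / 2 * (M + M) :=
        tsum_of_norm_bounded ((hasSum_abs_rieszWeight hΩ).mul_right (M + M)) fun n => by
          rw [norm_smul, norm_eq_abs]
          gcongr
          exact norm_sub_le_of_le (hM _) (hM _)
    _ = Ω * M := by ring

theorem norm_iteratedDeriv_fourier_le {M : ℝ} (hΩ : 0 < Ω) (hG : IsBandlimitedSpectrum Ω G)
    (hM : ∀ t, ‖𝓕 G t‖ ≤ M) (n : ℕ) (t : ℝ) : ‖iteratedDeriv n (𝓕 G) t‖ ≤ Ω ^ n * M := by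
  induction n generalizing G M with
  | zero => simpa using hM t
  | succ n ih =>
    rw [iteratedDeriv_succ', hG.deriv_fourier, pow_succ, mul_assoc (Ω ^ n)]
    exact ih hG.derivSpectrum fun s =>
      hG.deriv_fourier ▸ hG.norm_deriv_fourier_le hΩ hM s

end IsBandlimitedSpectrum

end Bernstein

section L2Inversion

open scoped ContDiff

variable {V F : Type*} [NormedAddCommGroup V] [InnerProductSpace ℝ V] [FiniteDimensional ℝ V]
  [MeasurableSpace V] [BorelSpace V]

theorem continuous_fourierInv_of_integrable [NormedAddCommGroup F] [NormedSpace ℂ F] {f : V → F}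
    (hf : Integrable f) : Continuous (𝓕⁻ f) := by
  rw [← Real.Lp.fourierTransformInv_toLp (memLp_one_iff_integrable.2 hf)]
  exact BoundedContinuousFunction.continuous _

theorem integral_fourierInv_smul_eq [NormedAddCommGroup F] [NormedSpace ℂ F] [CompleteSpace F]
    {φ : V → ℂ} {f : V → F} (hφ : Integrable φ) (hf : Integrable f) :
    ∫ v, 𝓕⁻ φ v • f v = ∫ v, φ v • 𝓕⁻ f v := by
  have hflip : (-innerₗ V).flip = -innerₗ V := by
    ext v w
    simp only [LinearMap.flip_apply, LinearMap.neg_apply, innerₗ_apply_apply, real_inner_comm]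
  have h := VectorFourier.integral_fourierIntegral_smul_eq_flip (L := -innerₗ V)
    Real.continuous_fourierChar continuous_inner.neg hφ hf
  rwa [hflip] at h

theorem coeFn_fourierInv_ae_eq [NormedAddCommGroup F] [InnerProductSpace ℂ F] [CompleteSpace F]
    (f : Lp F 2 (volume : Measure V)) (hf : Integrable f) :
    ((𝓕⁻ f : Lp F 2 (volume : Measure V)) : V → F) =ᵐ[volume] 𝓕⁻ (f : V → F) := by
  refine ae_eq_of_integral_contDiff_smul_eq ((Lp.memLp _).locallyIntegrable one_le_two)
    (continuous_fourierInv_of_integrable hf).locallyIntegrable fun φ hφ hφc => ?_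
  have hψc : HasCompactSupport (Complex.ofRealCLM ∘ φ) := hφc.comp_left Complex.ofReal_zero
  have hψ : ContDiff ℝ ∞ (Complex.ofRealCLM ∘ φ) := Complex.ofRealCLM.contDiff.comp hφ
  let ψ : SchwartzMap V ℂ := hψc.toSchwartzMap hψ
  have hpair (h : V → F) : ∫ v, φ v • h v = ∫ v, ψ v • h v :=
    integral_congr_ae (.of_forall fun v => (Complex.coe_smul (φ v) (h v)).symm)
  calc ∫ v, φ v • (𝓕⁻ f : Lp F 2 (volume : Measure V)) v
      = ((𝓕⁻ f : Lp F 2 (volume : Measure V)) : SchwartzMap V ℂ →Lₚₜ[ℂ] F) ψ := by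
        rw [hpair, Lp.toTemperedDistribution_apply]
    _ = (f : SchwartzMap V ℂ →Lₚₜ[ℂ] F) (𝓕⁻ ψ) := by
        rw [← Lp.fourierInv_toTemperedDistribution_eq, TemperedDistribution.fourierInv_apply]
    _ = ∫ v, 𝓕⁻ (ψ : V → ℂ) v • f v := by
        rw [Lp.toTemperedDistribution_apply, SchwartzMap.fourierInv_coe]
    _ = ∫ v, φ v • 𝓕⁻ (f : V → F) v := by
        rw [integral_fourierInv_smul_eq ψ.integrable hf, hpair]

end L2Inversion

namespace IsPaleyWiener

variable {Ω M : ℝ} {g : ℝ → ℝ}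

theorem integrable_fourier (hg : IsPaleyWiener Ω g) :
    Integrable ((𝓕 (hg.memLp.toLp fun t : ℝ => (g t : ℂ)) : Lp ℂ 2 (volume : Measure ℝ)) :
      ℝ → ℂ) := by
  have hon : IntegrableOn ((𝓕 (hg.memLp.toLp fun t : ℝ => (g t : ℂ)) :
      Lp ℂ 2 (volume : Measure ℝ)) : ℝ → ℂ) (Set.Icc (-(Ω / (2 * Real.pi))) (Ω / (2 * Real.pi))) :=
    ((Lp.memLp _).restrict _).integrable one_le_two
  refine hon.integrable_of_ae_notMem_eq_zero ?_
  filter_upwards [hg.bandlimited] with v hv hvI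
  refine hv (lt_of_not_ge fun hle => hvI ?_)
  rw [abs_mul, abs_of_pos Real.two_pi_pos, mul_comm] at hle
  rwa [Set.mem_Icc, ← abs_le, le_div_iff₀ Real.two_pi_pos]

theorem exists_spectrum (hg : IsPaleyWiener Ω g) :
    ∃ G : ℝ → ℂ, IsBandlimitedSpectrum Ω G ∧ 𝓕 G = fun t => (g t : ℂ) := by
  let F : Lp ℂ 2 (volume : Measure ℝ) := 𝓕 (hg.memLp.toLp fun t : ℝ => (g t : ℂ))
  have hF : Integrable F := hg.integrable_fourier
  refine ⟨fun v => F (-v), ⟨hF.comp_neg, ?_⟩, ?_⟩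
  · have hneg := (Measure.measurePreserving_neg (volume : Measure ℝ)).quasiMeasurePreserving.ae
      hg.bandlimited
    filter_upwards [hneg] with v hv h
    exact hv (by rwa [mul_neg, abs_neg])
  · have hae : 𝓕⁻ (F : ℝ → ℂ) =ᵐ[volume] fun t => (g t : ℂ) := by
      refine (coeFn_fourierInv_ae_eq F hF).symm.trans ?_
      rw [FourierTransform.fourierInv_fourier_eq]
      exact hg.memLp.coeFn_toLp
    rw [← Real.fourierInv_eq_fourier_comp_neg]
    exact ((continuous_fourierInv_of_integrable hF).ae_eq_iff_eq volume
      (Complex.continuous_ofReal.comp hg.continuous)).1 hae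

theorem contDiff (hg : IsPaleyWiener Ω g) (n : ℕ) : ContDiff ℝ n g := by
  obtain ⟨G, hG, hGg⟩ := hg.exists_spectrum
  have h := Complex.reCLM.contDiff.comp (hG.contDiff_fourier n)
  rwa [hGg] at h

/-- **Bernstein's inequality.** -/
theorem abs_iteratedDeriv_le (hΩ : 0 < Ω) (hg : IsPaleyWiener Ω g) (hM : ∀ t, |g t| ≤ M)
    (n : ℕ) (t : ℝ) : |iteratedDeriv n g t| ≤ Ω ^ n * M := by
  obtain ⟨G, hG, hGg⟩ := hg.exists_spectrum
  have hnorm : ‖iteratedDeriv n (𝓕 G) t‖ = ‖iteratedDeriv n g t‖ := by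
    rw [hGg, ← norm_iteratedFDeriv_eq_norm_iteratedDeriv,
      ← norm_iteratedFDeriv_eq_norm_iteratedDeriv]
    exact Complex.ofRealLI.norm_iteratedFDeriv_comp_left (hg.contDiff n).contDiffAt le_rfl
  rw [← Real.norm_eq_abs, ← hnorm]
  refine hG.norm_iteratedDeriv_fourier_le hΩ (fun s => ?_) n t
  rw [hGg, Complex.norm_real]
  exact hM s

end IsPaleyWiener

section ForwardDifferences

theorem iteratedDeriv_fwdDiff {𝕜 E : Type*} [NontriviallyNormedField 𝕜] [NormedAddCommGroup E]
    [NormedSpace 𝕜 E] {n : ℕ} {f : 𝕜 → E} (hf : ContDiff 𝕜 n f) (h : 𝕜) :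
    iteratedDeriv n (fwdDiff h f) = fwdDiff h (iteratedDeriv n f) := by
  ext t
  have hshift : ContDiff 𝕜 n fun s => f (s + h) := hf.comp (contDiff_id.add contDiff_const)
  exact (iteratedDeriv_sub hshift.contDiffAt hf.contDiffAt).trans
    (congrArg (· - _) (congrFun (iteratedDeriv_comp_add_const n f h) t))

theorem norm_fwdDiff_iter_le_of_norm_iteratedDeriv_le {E : Type*} [NormedAddCommGroup E]
    [NormedSpace ℝ E] {n : ℕ} {f : ℝ → E} {C : ℝ} (hf : ContDiff ℝ n f)
    (hC : ∀ t, ‖iteratedDeriv n f t‖ ≤ C) (h a : ℝ) : ‖(fwdDiff h)^[n] f a‖ ≤ C * |h| ^ n := by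
  induction n generalizing f C with
  | zero =>
    simpa only [Function.iterate_zero, id_eq, pow_zero, mul_one, iteratedDeriv_zero] using hC a
  | succ n ih =>
    have hn : ContDiff ℝ n f := hf.of_le (by exact_mod_cast n.le_succ)
    have hshift : ContDiff ℝ n fun t => f (t + h) := hn.comp (contDiff_id.add contDiff_const)
    have hdiff : Differentiable ℝ (iteratedDeriv n f) :=
      hf.differentiable_iteratedDeriv n (by exact_mod_cast n.lt_succ_self)
    rw [Function.iterate_succ_apply, pow_succ', ← mul_assoc]
    refine ih (hshift.sub hn) fun t => ?_
    calc ‖iteratedDeriv n (fwdDiff h f) t‖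
        = ‖iteratedDeriv n f (t + h) - iteratedDeriv n f t‖ := by
          rw [iteratedDeriv_fwdDiff hn, fwdDiff]
      _ ≤ C * ‖t + h - t‖ := convex_univ.norm_image_sub_le_of_norm_deriv_le (fun s _ => hdiff s)
          (fun s _ => by simpa only [iteratedDeriv_succ] using hC s) (Set.mem_univ t)
          (Set.mem_univ (t + h))
      _ = C * |h| := by rw [add_sub_cancel_left, Real.norm_eq_abs]

theorem norm_fwdDiff_iter_le_two_pow_mul {A E : Type*} [AddCommMonoid A] [SeminormedAddCommGroup E]
    {x : A → E} {C : ℝ} (hx : ∀ a, ‖x a‖ ≤ C) (h : A) (n : ℕ) (a : A) :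
    ‖(fwdDiff h)^[n] x a‖ ≤ 2 ^ n * C := by
  induction n generalizing a with
  | zero => simpa only [Function.iterate_zero, id_eq, pow_zero, one_mul] using hx a
  | succ n ih =>
    rw [Function.iterate_succ_apply', pow_succ]
    exact (norm_sub_le_of_le (ih (a + h)) (ih a)).trans_eq (by ring)

theorem fwdDiff_iter_sample {E : Type*} [AddCommGroup E] (f : ℝ → E) (T : ℝ) (n : ℕ) (k : ℤ) :
    (fwdDiff 1)^[n] (fun j : ℤ => f (j * T)) k = (fwdDiff T)^[n] f (k * T) := by
  induction n generalizing k with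
  | zero => rfl
  | succ n ih =>
    rw [Function.iterate_succ_apply', Function.iterate_succ_apply', fwdDiff, fwdDiff, ih, ih,
      Int.cast_add, Int.cast_one, add_one_mul]

end ForwardDifferences

namespace IsPaleyWiener

variable {Ω M N T δ : ℝ} {g : ℝ → ℝ}

theorem abs_sub_le (hΩ : 0 < Ω) (hg : IsPaleyWiener Ω g) (hM : ∀ t, |g t| ≤ M) (s t : ℝ) :
    |g t - g s| ≤ Ω * M * |t - s| :=
  convex_univ.norm_image_sub_le_of_norm_deriv_le
    (fun _ _ => (hg.contDiff 1).differentiable one_ne_zero _)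
    (fun u _ => by
      simpa only [iteratedDeriv_one, pow_one, Real.norm_eq_abs] using
        hg.abs_iteratedDeriv_le hΩ hM 1 u)
    (Set.mem_univ s) (Set.mem_univ t)

theorem abs_fwdDiff_iter_sample_le (hΩ : 0 < Ω) (hg : IsPaleyWiener Ω g) (hM : ∀ t, |g t| ≤ M)
    {μ : ℤ → ℝ} (hμ : ∀ k, |μ k| ≤ δ) (n : ℕ) (k : ℤ) :
    |(fwdDiff 1)^[n] (fun j : ℤ => g (j * T + μ j)) k| ≤ M * ((|T| * Ω) ^ n + 2 ^ n * (δ * Ω)) := by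
  have hM₀ : 0 ≤ M := (abs_nonneg _).trans (hM 0)
  let u : ℤ → ℝ := fun j => g (j * T)
  let w : ℤ → ℝ := fun j => g (j * T + μ j) - g (j * T)
  have hu : |(fwdDiff 1)^[n] u k| ≤ Ω ^ n * M * |T| ^ n := by
    rw [fwdDiff_iter_sample]
    exact norm_fwdDiff_iter_le_of_norm_iteratedDeriv_le (hg.contDiff n)
      (hg.abs_iteratedDeriv_le hΩ hM n) T (k * T)
  have hjitter (j : ℤ) : |w j| ≤ Ω * M * δ :=
    calc |w j| ≤ Ω * M * |j * T + μ j - j * T| := hg.abs_sub_le hΩ hM _ _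
      _ = Ω * M * |μ j| := by rw [add_sub_cancel_left]
      _ ≤ Ω * M * δ := by gcongr; exact hμ j
  have hw : |(fwdDiff 1)^[n] w k| ≤ 2 ^ n * (Ω * M * δ) :=
    norm_fwdDiff_iter_le_two_pow_mul (x := w) (C := Ω * M * δ) hjitter 1 n k
  have hsplit : (fun j : ℤ => g (j * T + μ j)) = u + w :=
    funext fun j => (add_sub_cancel (g (j * T)) (g (j * T + μ j))).symm
  rw [hsplit, fwdDiff_iter_add]
  calc |(fwdDiff 1)^[n] u k + (fwdDiff 1)^[n] w k|
      ≤ Ω ^ n * M * |T| ^ n + 2 ^ n * (Ω * M * δ) := (abs_add_le _ _).trans (add_le_add hu hw)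
    _ = M * ((|T| * Ω) ^ n + 2 ^ n * (δ * Ω)) := by ring

theorem abs_fwdDiff_iter_noisy_sample_le (hΩ : 0 < Ω) (hg : IsPaleyWiener Ω g)
    (hM : ∀ t, |g t| ≤ M) {μ η : ℤ → ℝ} (hμ : ∀ k, |μ k| ≤ δ) (hη : ∀ k, |η k| ≤ N) (n : ℕ)
    (k : ℤ) :
    |(fwdDiff 1)^[n] (fun j : ℤ => g (j * T + μ j) + η j) k|
      ≤ M * ((|T| * Ω) ^ n + 2 ^ n * (δ * Ω)) + 2 ^ n * N := by
  have hsplit : (fun j : ℤ => g (j * T + μ j) + η j) = (fun j : ℤ => g (j * T + μ j)) + η := rfl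
  rw [hsplit, fwdDiff_iter_add]
  exact (abs_add_le _ _).trans (add_le_add (hg.abs_fwdDiff_iter_sample_le hΩ hM hμ n k)
    (norm_fwdDiff_iter_le_two_pow_mul (x := η) (C := N) hη 1 n k))

end IsPaleyWiener

theorem abs_le_supNorm {ι : Type*} {f : ι → ℝ} (hf : BddAbove (Set.range fun i => |f i|)) (i : ι) :
    |f i| ≤ supNorm f :=
  le_ciSup hf i

theorem antiDiff_fwdDiff (x : ℤ → ℝ) (k : ℤ) : antiDiff (fwdDiff 1 x) k = x k - x 1 := by
  unfold antiDiff
  rcases le_total 1 k with h | h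
  · rw [Finset.Ico_eq_empty_of_le h, Finset.sum_empty, sub_zero]
    induction k, h using Int.leInduction with
    | base => rw [Finset.Ico_self, Finset.sum_empty, sub_self]
    | succ k hk ih =>
      rw [← Finset.insert_Ico_right_eq_Ico_add_one hk, Finset.sum_insert Finset.right_notMem_Ico,
        ih, fwdDiff, sub_add_sub_cancel]
  · rw [Finset.Ico_eq_empty_of_le h, Finset.sum_empty, zero_sub]
    induction k, h using Int.leInductionDown with
    | base => rw [Finset.Ico_self, Finset.sum_empty, sub_self, neg_zero]
    | pred k hk ih =>
      rw [← Finset.insert_Ico_add_one_left_eq_Ico (by lia : k - 1 < 1), sub_add_cancel,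
        Finset.sum_insert (by simp), neg_add, ih, fwdDiff, sub_add_cancel]
      ring

section ModFold

variable {l : ℝ}

theorem modFold_eq_toIcoMod (hl : 0 < l) (x : ℝ) :
    modFold l x = toIcoMod (mul_pos two_pos hl) (-l) x := by
  rw [modFold, toIcoMod, toIcoDiv_eq_floor, sub_neg_eq_add, zsmul_eq_mul, mul_comm]

theorem abs_modFold_le (hl : 0 < l) (x : ℝ) : |modFold l x| ≤ l := by
  obtain ⟨h₁, h₂⟩ := toIcoMod_mem_Ico (mul_pos two_pos hl) (-l) x
  rw [modFold_eq_toIcoMod hl]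
  exact abs_le.2 ⟨h₁, by linarith⟩

theorem modFold_add_mul_intCast (hl : 0 < l) (x : ℝ) (n : ℤ) :
    modFold l (x + 2 * l * n) = modFold l x := by
  rw [modFold_eq_toIcoMod hl, modFold_eq_toIcoMod hl, mul_comm _ (n : ℝ), ← zsmul_eq_mul,
    toIcoMod_add_zsmul]

theorem modFold_eq_self (hl : 0 < l) {x : ℝ} (hx : |x| < l) : modFold l x = x := by
  obtain ⟨h₁, h₂⟩ := abs_lt.1 hx
  rw [modFold_eq_toIcoMod hl, toIcoMod_eq_self]
  exact ⟨h₁.le, by linarith⟩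

end ModFold

theorem fwdDiff_mul_intCast (c : ℝ) (e : ℤ → ℤ) :
    fwdDiff (1 : ℤ) (fun k => c * (e k : ℝ)) = fun k => c * (fwdDiff 1 e k : ℤ) := by
  ext k
  rw [fwdDiff, fwdDiff, Int.cast_sub, mul_sub]

namespace RSoD

variable {l β : ℝ} {y z : ℤ → ℝ} {e : ℤ → ℤ}

theorem resDiff_eq_fwdDiff_iter (hl : 0 < l) (hy : ∀ k, y k = z k - 2 * l * e k)
    (hz : ∀ k, |(fwdDiff (1 : ℤ))^[2] z k| < l) :
    resDiff l y = (fwdDiff 1)^[2] fun k => 2 * l * (e k : ℝ) := by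
  ext k
  have hadd : z = y + fun k => 2 * l * (e k : ℝ) :=
    funext fun k => by rw [Pi.add_apply, hy, sub_add_cancel]
  have hsum : (fwdDiff 1)^[2] y k + 2 * l * ((fwdDiff 1)^[2] e k : ℤ) = (fwdDiff 1)^[2] z k := by
    rw [hadd, fwdDiff_iter_add, Pi.add_apply]
    simp only [Function.iterate_succ_apply, Function.iterate_zero_apply, fwdDiff_mul_intCast]
  have hfold : modFold l ((fwdDiff 1)^[2] y k) = (fwdDiff 1)^[2] z k := by
    rw [← modFold_add_mul_intCast hl _ ((fwdDiff 1)^[2] e k), hsum, modFold_eq_self hl (hz k)]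
  rw [resDiff, hfold, hadd, fwdDiff_iter_add, Pi.add_apply, add_sub_cancel_left]

theorem antiDiff_resDiff (hr : resDiff l y = (fwdDiff 1)^[2] fun k => 2 * l * (e k : ℝ)) (k : ℤ) :
    antiDiff (resDiff l y) k = 2 * l * ((fwdDiff 1 e k - fwdDiff 1 e 1 : ℤ) : ℝ) := by
  rw [hr, Function.iterate_succ_apply', Function.iterate_one, antiDiff_fwdDiff,
    fwdDiff_mul_intCast, Int.cast_sub, mul_sub]

theorem antiDiff_antiDiff_resDiff
    (hr : resDiff l y = (fwdDiff 1)^[2] fun k => 2 * l * (e k : ℝ)) (k : ℤ) :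
    antiDiff (antiDiff (resDiff l y)) k
      = 2 * l * ((e k - e 1 - (k - 1) * fwdDiff 1 e 1 : ℤ) : ℝ) := by
  have hprim : antiDiff (resDiff l y)
      = fwdDiff 1 fun k : ℤ => 2 * l * ((e k - k * fwdDiff 1 e 1 : ℤ) : ℝ) := by
    ext k
    rw [antiDiff_resDiff hr, fwdDiff_mul_intCast]
    simp only [fwdDiff]
    push_cast
    ring
  rw [hprim, antiDiff_fwdDiff]
  push_cast
  ring

theorem four_mul_add_le_blockLength_mul (hl : 0 < l) (β : ℝ) :
    4 * (β + l) ≤ blockLength l β * l :=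
  calc 4 * (β + l) = 4 * (β / l + 1) * l := by field_simp
    _ ≤ blockLength l β * l := by
      gcongr
      exact Int.le_ceil _

theorem kappa_eq (hl : 0 < l) (hr : resDiff l y = (fwdDiff 1)^[2] fun k => 2 * l * (e k : ℝ))
    (he : ∀ k, |2 * l * e k| < 2 * (β + l)) : kappa l β y = fwdDiff 1 e 1 := by
  have hJl := four_mul_add_le_blockLength_mul hl β
  rw [kappa, antiDiff_antiDiff_resDiff hr, antiDiff_antiDiff_resDiff hr]
  generalize blockLength l β = J at hJl ⊢
  have hJl₀ : 0 < J * l := by linarith [(abs_nonneg _).trans_lt (he 1)]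
  have hdrift : |(2 * l * e (J + 1) - 2 * l * e 1) / (2 * (J * l))| < 1 / 2 := by
    rw [abs_div, abs_of_pos (by positivity : 0 < 2 * (J * l)), div_lt_iff₀ (by positivity)]
    linarith [abs_sub (2 * l * (e (J + 1) : ℝ)) (2 * l * e 1), he 1, he (J + 1)]
  have hsplit : (2 * l * ((e 1 - e 1 - (1 - 1) * fwdDiff 1 e 1 : ℤ) : ℝ)
        - 2 * l * ((e (J + 1) - e 1 - (J + 1 - 1) * fwdDiff 1 e 1 : ℤ) : ℝ)) / (2 * J * l)
      = fwdDiff 1 e 1 - (2 * l * e (J + 1) - 2 * l * e 1) / (2 * (J * l)) := by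
    have hJ : (J : ℝ) ≠ 0 := left_ne_zero_of_mul hJl₀.ne'
    push_cast
    field_simp
    ring
  obtain ⟨h₁, h₂⟩ := abs_lt.1 hdrift
  rw [hsplit, Int.floor_eq_iff]
  constructor <;> linarith

theorem firstDiff_eq (hl : 0 < l) (hr : resDiff l y = (fwdDiff 1)^[2] fun k => 2 * l * (e k : ℝ))
    (he : ∀ k, |2 * l * e k| < 2 * (β + l)) :
    firstDiff l β y = fwdDiff 1 fun k => 2 * l * (e k : ℝ) := by
  ext k
  rw [firstDiff, antiDiff_resDiff hr, kappa_eq hl hr he, mul_div_cancel_left₀ _ (by positivity),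
    round_intCast, ← mul_add, ← Int.cast_add, sub_add_cancel, fwdDiff_mul_intCast]

theorem exists_recover_eq (hl : 0 < l) (hβ : ∀ k, |z k| < 2 * β + l)
    (hz : ∀ k, |(fwdDiff (1 : ℤ))^[2] z k| < l) :
    ∃ c : ℤ, ∀ m k : ℤ,
      recover l β (fun k => modFold l (z k)) m k = z k + 2 * ((m + c : ℤ) : ℝ) * l := by
  let e : ℤ → ℤ := fun k => ⌊(z k + l) / (2 * l)⌋
  have hy (k : ℤ) : modFold l (z k) = z k - 2 * l * e k := rfl
  have he (k : ℤ) : |2 * l * e k| < 2 * (β + l) :=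
    calc |2 * l * e k| = |z k - modFold l (z k)| := by rw [hy, sub_sub_cancel]
      _ ≤ |z k| + |modFold l (z k)| := abs_sub _ _
      _ < 2 * β + l + l := add_lt_add_of_lt_of_le (hβ k) (abs_modFold_le hl _)
      _ = 2 * (β + l) := by ring
  refine ⟨-e 1, fun m k => ?_⟩
  rw [recover, firstDiff_eq hl (resDiff_eq_fwdDiff_iter hl hy hz) he, antiDiff_fwdDiff, hy]
  push_cast
  ring

end RSoD

section SamplingCondition

theorem lt_neg_add_sqrt_iff {p c x : ℝ} (hx : 0 ≤ x + p) :
    x < -p + √(p ^ 2 + c) ↔ x ^ 2 + 2 * p * x < c := by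
  rw [lt_neg_add_iff_add_lt, add_comm p, Real.lt_sqrt hx, add_sq]
  constructor <;> intro h <;> linarith

theorem mul_sq_add_lt_one_iff_lt_neg_add_sqrt {r s ν x : ℝ} (hr : 0 < r) (hx : 0 ≤ x + 2 * ν) :
    r * (x ^ 2 + 4 * ν * x) + 4 * s < 1 ↔ x < -2 * ν + √(4 * ν ^ 2 + (1 - 4 * s) / r) := by
  have h := lt_neg_add_sqrt_iff (c := (1 - 4 * s) / r) hx
  rw [lt_div_iff₀ hr] at h
  rw [show -2 * ν + √(4 * ν ^ 2 + (1 - 4 * s) / r) = -(2 * ν) + √((2 * ν) ^ 2 + (1 - 4 * s) / r)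
    by ring_nf, h]
  constructor <;> intro h <;> linarith

theorem oversamplingFactor_eq_pi_div (T Ω : ℝ) : oversamplingFactor T Ω = Real.pi / (T * Ω) := by
  rw [oversamplingFactor]
  field_simp

end SamplingCondition

theorem theorem2
    (l T Ω ν : ℝ) (hl : 0 < l) (hT : 0 < T) (hΩ : 0 < Ω) (hν : 0 ≤ ν)
    (g : ℝ → ℝ) (hg : IsPaleyWiener Ω g) (hgb : BddAbove (Set.range fun s => |g s|))
    (t μ : ℤ → ℝ) (ht : ∀ k, t k = (k : ℝ) * T + μ k) (hμ : ∀ k, |μ k| ≤ ν * T)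
    (η : ℤ → ℝ) (hη : BddAbove (Set.range fun k => |η k|))
    (γ y : ℤ → ℝ) (hγ : ∀ k, γ k = g (t k)) (hy : ∀ k, y k = modFold l (γ k + η k))
    (ρ ρη : ℝ) (hρ : ρ = supNorm g / l) (hρη : ρη = supNorm η / l) :
    -- recovery up to a global multiple of `2 l`
    (ρ * ((T * Ω) ^ 2 + 4 * ν * (T * Ω)) + 4 * ρη < 1 →
      ∀ β : ℝ, supNorm g ≤ β →
        ∃ c : ℤ, ∀ m k : ℤ, RSoD.recover l β y m k = γ k + η k + 2 * ((m + c : ℤ) : ℝ) * l) ∧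
    -- the two equivalent forms of the condition
    (0 < ρ → ρη < 1 / 4 →
      (ρ * ((T * Ω) ^ 2 + 4 * ν * (T * Ω)) + 4 * ρη < 1 ↔
        T * Ω < -2 * ν + Real.sqrt (4 * ν ^ 2 + (1 - 4 * ρη) / ρ)) ∧
      (ρ * ((T * Ω) ^ 2 + 4 * ν * (T * Ω)) + 4 * ρη < 1 ↔
        Real.pi / (-2 * ν + Real.sqrt (4 * ν ^ 2 + (1 - 4 * ρη) / ρ))
          < oversamplingFactor T Ω)) := by
  obtain rfl := funext ht
  obtain rfl := funext hγ
  obtain rfl := funext hy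
  have hx : 0 < T * Ω := mul_pos hT hΩ
  refine ⟨fun hcond β hβ => ?_, fun hρ₀ hρη₁ => ?_⟩
  · have hgM := abs_le_supNorm hgb
    have hηM := abs_le_supNorm hη
    have hM : 0 ≤ supNorm g := (abs_nonneg _).trans (hgM 0)
    have hcond' : supNorm g * ((T * Ω) ^ 2 + 2 ^ 2 * (ν * T * Ω)) + 2 ^ 2 * supNorm η < l := by
      rw [hρ, hρη, div_mul_eq_mul_div, mul_div_assoc', ← add_div, div_lt_one hl] at hcond
      linarith
    refine RSoD.exists_recover_eq hl (fun k => ?_) fun k => ?_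
    · have hηl : 2 ^ 2 * supNorm η < l :=
        (le_add_of_nonneg_left (by positivity)).trans_lt hcond'
      linarith [abs_add_le (g (k * T + μ k)) (η k), hgM (k * T + μ k), hηM k]
    · refine (hg.abs_fwdDiff_iter_noisy_sample_le hΩ hgM hμ hηM 2 k).trans_lt ?_
      rwa [abs_of_pos hT]
  · have hbound : 0 < -2 * ν + √(4 * ν ^ 2 + (1 - 4 * ρη) / ρ) :=
      (mul_sq_add_lt_one_iff_lt_neg_add_sqrt hρ₀ (by positivity)).1 (by linarith)
    rw [oversamplingFactor_eq_pi_div, div_lt_div_iff_of_pos_left Real.pi_pos hbound hx, and_self]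
    exact mul_sq_add_lt_one_iff_lt_neg_add_sqrt hρ₀ (by positivity)
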